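/- For $m,k\in\mathbb{N}$, an $m$-cover of $[k]=\{1,\dots,k\}$ is a collection (a multiset: repetitions are allowed and order is irrelevant) of nonempty subsets of $[k]$ such that each $j\in[k]$ belongs to exactly $m$ of them, counted with multiplicity. Let $v_{k;m}$ be the (finite) number of $m$-covers of $[k]$. Let $Z_{1},Z_{1/2},\dots,Z_{1/m}$ be independent random variables, $Z_{1/j}$ having the Poisson distribution with parameter $1/j$, and put $$\mathcal{E}_m=\sum_{\substack{(l_1,\dots,l_m):\ \sum_{j=1}^m j\,l_j=m\\ 0\le l_j\le Z_{1/j},\ 1\le j\le m}}\ \prod_{j=1}^m\binom{Z_{1/j}}{l_j}.$$ Then for all $m,k\in\mathbb{N}$ the $k$-th moment of $\mathcal{E}_m$ exists and $$E\,\mathcal{E}_m^k=v_{k;m}.$$ In particular $E\,\mathcal{E}_m=1$, $E\,\mathcal{E}_m^2=m+1$ and $\mathrm{Var}(\mathcal{E}_m)=m$. Moreover, if $\mathcal{E}^{(n)}_m(\sigma)$ denotes the number of sets $A\subset[n]$ with $|A|=m$ and $\sigma(A)=A$, for a permutation $\sigma$ of $[n]$, and $E_n$ is the expectation with respect to the uniform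 distribution on the permutations of $[n]$, then $E_n(\mathcal{E}^{(n)}_m)^k=v_{k;m}$ whenever $n\ge km$. -/

import Mathlib

/-- The number of sets of cardinality `m` that are fixed (as sets) by the permutation `σ` of an
`n`-element set. -/
def fixedSetCount {n : ℕ} (m : ℕ) (σ : Equiv.Perm (Fin n)) : ℕ :=
  ((Finset.powersetCard m (Finset.univ : Finset (Fin n))).filter fun A => A.image σ = A).card

/-- The sum, over all `(l_1, …, l_m)` with `∑ j, j * l_j = m` and `l_j ≤ z_j` for all `j`, of
`∏ j, (z_j choose l_j)`. The index `j : Fin m` stands for the cycle length `j + 1`. -/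
def fixedSetSum (m : ℕ) (z : Fin m → ℕ) : ℕ :=
  ∑ l ∈ (Fintype.piFinset fun j => Finset.range (z j + 1)).filter
      (fun l => ∑ j : Fin m, ((j : ℕ) + 1) * l j = m),
    ∏ j, (z j).choose (l j)

/-- The `m`-covers of a `k`-element set: collections (with repetitions allowed, without order) of
nonempty subsets such that each element lies in exactly `m` of them, counted with multiplicity. -/
def mCovers (k m : ℕ) : Set (Multiset (Finset (Fin k))) :=
  {S | (∀ Γ ∈ S, Γ.Nonempty) ∧ ∀ j : Fin k, S.countP (fun Γ => j ∈ Γ) = m}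

/-- There are only finitely many `m`-covers, so counting them with `Set.ncard` is meaningful. -/
theorem mCovers_finite (k m : ℕ) : (mCovers k m).Finite := by
  refine Set.Finite.of_injOn (f := fun S => fun Γ => S.count Γ)
    (t := Set.Iic (fun _ : Finset (Fin k) => m)) ?_ ?_ (Set.finite_Iic _)
  · rintro S ⟨hne, hS⟩ Γ
    by_cases hΓ : Γ ∈ S
    · obtain ⟨j, hj⟩ := hne Γ hΓ
      have h := hS j
      simp only
      rw [← h, Multiset.count, Multiset.countP_eq_card_filter, Multiset.countP_eq_card_filter]
      exact Multiset.card_le_card (Multiset.monotone_filter_right S fun b hb => hb ▸ hj)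
    · simp [Multiset.count_eq_zero_of_notMem hΓ]
  · intro S _ T _ h
    exact Multiset.ext.2 fun Γ => congrFun h Γ

/-- The total number `v_{k;m}` of `m`-covers of a `k`-element set, regardless of order. -/
noncomputable def coverCount (k m : ℕ) : ℕ := (mCovers k m).ncard

/-!
Both moment formulas count the same objects, along two independent routes.

*Permutations.* The symmetric group acts on `k`-tuples of `m`-subsets of `Fin n`, and a permutation
`σ` fixes `(fixedSetCount m σ) ^ k` of them. By Burnside's lemma the `k`-th moment is the number of
orbits. A tuple `A` is determined up to relabelling by the multiset of its atoms
`{i | x ∈ A i}`, `x : Fin n`; the nonempty ones form an `m`-cover, and the number of empty ones is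
then forced. Every `m`-cover has at most `k * m` members, so for `k * m ≤ n` all of them occur
(`card_orbits_eq_coverCount`).

*Poisson variables.* Expanding `(1 + x₁)^z ⋯ (1 + x_k)^z = (1 + ∑_{Γ ≠ ∅} ∏_{i ∈ Γ} x_i)^z` with
the binomial and multinomial theorems, and using that a Poisson variable of rate `r` satisfies
`E (Z choose s) = r ^ s / s!`, one gets
`E ∏ i, (Z choose l_i) = ∑_c ∏_Γ r ^ c_Γ / c_Γ!`, where `c` runs over the vectors of
multiplicities of nonempty subsets which cover each `i` exactly `l_i` times
(`integral_poisson_prod_choose`). With independence, the `k`-th moment becomes a sum over arrays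
`c_{j, Γ}` of nonnegative integers, which is regrouped according to `d_Γ = ∑ j, j * c_{j, Γ}`
(`sum_prod_sum_coverDegree_eq`). The vectors `d` which occur are exactly the `m`-covers, and each
contributes `∏_Γ ∑_{∑ j c_j = d_Γ} ∏ j, 1 / (j ^ c_j * c_j!)`. Every factor is `1`
(`sum_prod_cycleWeight_eq_one`): it is the total probability of the cycle types of a random
permutation of `d_Γ` points.
-/

open MeasureTheory ProbabilityTheory
open scoped Pointwise

/-! ### Orbits of tuples of sets and Burnside's lemma -/

/-- Functions on a finite type with the same multiset of values differ by a permutation of the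
argument, because their fibres have the same cardinalities. -/
theorem exists_perm_comp_eq_of_map_univ_eq {α β : Type*} [Fintype α] [DecidableEq β]
    {f g : α → β} (h : Finset.univ.val.map f = Finset.univ.val.map g) :
    ∃ σ : Equiv.Perm α, ∀ x, g (σ x) = f x := by
  classical
  have hc : ∀ b, Nonempty ({x // f x = b} ≃ {x // g x = b}) := fun b => by
    refine ⟨Fintype.equivOfCardEq ?_⟩
    have := congrArg (Multiset.count b) h
    rw [Multiset.count_map, Multiset.count_map] at this
    rw [Fintype.card_subtype, Fintype.card_subtype, Finset.card, Finset.card]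
    simpa [Finset.filter, eq_comm] using this
  exact ⟨Equiv.ofFiberEquiv fun b => (hc b).some, Equiv.ofFiberEquiv_map _⟩

/-- A multiset of sets is determined by its nonempty members and its cardinality. -/
theorem Multiset.eq_of_filter_nonempty_eq {α : Type*} [DecidableEq α] {S T : Multiset (Finset α)}
    (h : S.filter Finset.Nonempty = T.filter Finset.Nonempty) (hcard : S.card = T.card) :
    S = T := by
  have key : ∀ U : Multiset (Finset α), U.filter (fun Γ => ¬ Γ.Nonempty) =
      Multiset.replicate (U.card - (U.filter Finset.Nonempty).card) ∅ := fun U => by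
    rw [Multiset.eq_replicate]
    constructor
    · have := congrArg Multiset.card (Multiset.filter_add_not Finset.Nonempty U)
      rw [Multiset.card_add] at this
      omega
    · intro Γ hΓ
      simpa [Finset.not_nonempty_iff_eq_empty] using (Multiset.mem_filter.1 hΓ).2
  rw [← Multiset.filter_add_not Finset.Nonempty S, ← Multiset.filter_add_not Finset.Nonempty T,
    key, key, h, hcard]

section Orbits

variable {n k m : ℕ}

/-- The atom of a family of sets `A` at a point `x`: the set of indices `i` with `x ∈ A i`. -/
def atom (A : Fin k → Set.powersetCard (Fin n) m) (x : Fin n) : Finset (Fin k) :=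
  Finset.univ.filter fun i => x ∈ (A i : Finset (Fin n))

/-- The multiset of nonempty atoms of a family of sets, one for each point lying in some member of
the family. -/
def atomCover (A : Fin k → Set.powersetCard (Fin n) m) : Multiset (Finset (Fin k)) :=
  ((Finset.univ : Finset (Fin n)).val.map (atom A)).filter Finset.Nonempty

theorem mem_atom {A : Fin k → Set.powersetCard (Fin n) m} {x : Fin n} {i : Fin k} :
    i ∈ atom A x ↔ x ∈ (A i : Finset (Fin n)) := by
  simp [atom]

theorem atomCover_mem_mCovers (A : Fin k → Set.powersetCard (Fin n) m) :
    atomCover A ∈ mCovers k m := by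
  refine ⟨fun Γ hΓ => (Multiset.mem_filter.1 hΓ).2, fun j => ?_⟩
  rw [atomCover, Multiset.countP_filter, Multiset.countP_map]
  refine Eq.trans ?_ (Set.powersetCard.card_eq (A j))
  change (Finset.univ.filter fun x => j ∈ atom A x ∧ (atom A x).Nonempty).card = _
  congr 1
  ext x
  simp only [mem_atom, Finset.mem_filter, Finset.mem_univ, true_and]
  exact ⟨fun h => h.1, fun h => ⟨h, j, mem_atom.2 h⟩⟩

theorem atom_smul (σ : Equiv.Perm (Fin n)) (A : Fin k → Set.powersetCard (Fin n) m) (x : Fin n) :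
    atom (σ • A) x = atom A (σ⁻¹ x) := by
  ext i
  rw [mem_atom, mem_atom, Pi.smul_apply, Set.powersetCard.coe_smul,
    ← Finset.inv_smul_mem_iff]
  rfl

theorem atomCover_smul (σ : Equiv.Perm (Fin n)) (A : Fin k → Set.powersetCard (Fin n) m) :
    atomCover (σ • A) = atomCover A := by
  unfold atomCover
  congr 1
  rw [funext (atom_smul σ A)]
  conv_rhs => rw [← Multiset.map_univ_val_equiv σ⁻¹, Multiset.map_map]
  rfl

theorem exists_smul_eq_of_atomCover_eq {A B : Fin k → Set.powersetCard (Fin n) m}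
    (h : atomCover A = atomCover B) : ∃ σ : Equiv.Perm (Fin n), σ • B = A := by
  obtain ⟨σ, hσ⟩ := exists_perm_comp_eq_of_map_univ_eq
    (Multiset.eq_of_filter_nonempty_eq h (by simp))
  refine ⟨σ⁻¹, funext fun i => Subtype.ext (Finset.ext fun x => ?_)⟩
  have h1 : i ∈ atom (σ⁻¹ • B) x ↔ i ∈ atom A x := by rw [atom_smul, inv_inv, hσ]
  exact (mem_atom.symm.trans h1).trans mem_atom

/-- Double counting of incidences, each member of the cover having at least one element. -/
theorem card_le_of_mem_mCovers {S : Multiset (Finset (Fin k))} (hS : S ∈ mCovers k m) :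
    S.card ≤ k * m := by
  have h1 : ∀ T : Multiset (Finset (Fin k)),
      (T.map Finset.card).sum = ∑ j, T.countP (fun Γ => j ∈ Γ) := fun T => by
    induction T using Multiset.induction_on with
    | empty => simp
    | cons Γ T ih =>
      simp [Multiset.countP_cons, Finset.sum_add_distrib, ih, add_comm]
  have h2 : (S.map Finset.card).sum = k * m := by
    rw [h1, Finset.sum_congr rfl fun j _ => hS.2 j]; simp
  rw [← h2]
  have := Multiset.card_nsmul_le_sum (s := S.map Finset.card) (a := 1) (by
    intro x hx
    obtain ⟨Γ, hΓ, rfl⟩ := Multiset.mem_map.1 hx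
    exact (hS.1 Γ hΓ).card_pos)
  simpa using this

/-- Pad the cover with empty sets to a multiset of cardinality `n`, and let its members be the
atoms. -/
theorem exists_atomCover_eq (hn : k * m ≤ n) {S : Multiset (Finset (Fin k))}
    (hS : S ∈ mCovers k m) : ∃ A : Fin k → Set.powersetCard (Fin n) m, atomCover A = S := by
  set T := S + Multiset.replicate (n - S.card) ∅ with hT
  have hcard : T.card = n := by
    have := card_le_of_mem_mCovers hS
    simp [hT]; omega
  obtain ⟨f, hf⟩ : ∃ f : Fin n → Finset (Fin k), Finset.univ.val.map f = T := by
    clear_value T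
    clear hT hS hn
    subst hcard
    refine ⟨fun i => T.toList.get (i.cast (by simp)), ?_⟩
    rw [Fin.univ_val_map]
    conv_rhs => rw [← T.coe_toList]
    congr 1
    apply List.ext_get
    · simp
    · intro i h1 h2
      simp
  have hm : ∀ i, (Finset.univ.filter fun x => i ∈ f x).card = m := fun i => by
    have h1 : T.countP (fun Γ => i ∈ Γ) = m := by
      rw [hT, Multiset.countP_add, hS.2 i]
      simp [Multiset.countP_eq_zero, Multiset.mem_replicate]
    rw [← hf, Multiset.countP_map] at h1
    exact h1
  refine ⟨fun i => Set.powersetCard.ofCard (hm i), ?_⟩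
  have hatom : atom (fun i => Set.powersetCard.ofCard (hm i)) = f := by
    ext x i
    rw [mem_atom, Set.powersetCard.val_ofCard]
    simp
  rw [atomCover, hatom, hf, hT, Multiset.filter_add, Multiset.filter_eq_self.2 hS.1]
  simp [Multiset.filter_eq_nil, Multiset.mem_replicate]

theorem card_orbits_eq_coverCount (hn : k * m ≤ n) :
    Nat.card (MulAction.orbitRel.Quotient (Equiv.Perm (Fin n))
      (Fin k → Set.powersetCard (Fin n) m)) = coverCount k m := by
  rw [coverCount, ← Nat.card_coe_set_eq]
  refine Nat.card_congr (Equiv.ofBijective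
    (Quotient.lift (fun A => (⟨atomCover A, atomCover_mem_mCovers A⟩ : mCovers k m)) ?_) ⟨?_, ?_⟩)
  · rintro _ B ⟨σ, rfl⟩
    exact Subtype.ext (atomCover_smul σ B)
  · rintro ⟨A⟩ ⟨B⟩ h
    exact Quotient.sound (exists_smul_eq_of_atomCover_eq (congrArg Subtype.val h))
  · rintro ⟨S, hS⟩
    obtain ⟨A, hA⟩ := exists_atomCover_eq hn hS
    exact ⟨⟦A⟧, Subtype.ext hA⟩

theorem card_fixedBy_eq_fixedSetCount_pow (σ : Equiv.Perm (Fin n)) :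
    Nat.card (MulAction.fixedBy (Fin k → Set.powersetCard (Fin n) m) σ) =
      fixedSetCount m σ ^ k := by
  have e : MulAction.fixedBy (Fin k → Set.powersetCard (Fin n) m) σ ≃
      (Fin k → {A : Finset (Fin n) // A ∈
        (Finset.powersetCard m Finset.univ).filter fun A => A.image σ = A}) :=
    { toFun := fun A i => ⟨(A.1 i).1, by
        refine Finset.mem_filter.2 ⟨by simp, ?_⟩
        exact congrArg Subtype.val (congrFun A.2 i)⟩
      invFun := fun A => ⟨fun i => Set.powersetCard.ofCard (s := (A i).1)
        (Finset.mem_powersetCard.1 (Finset.mem_filter.1 (A i).2).1).2, by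
          refine funext fun i => Subtype.ext ?_
          exact (Finset.mem_filter.1 (A i).2).2⟩
      left_inv := fun A => rfl
      right_inv := fun A => rfl }
  rw [Nat.card_congr e, Nat.card_eq_fintype_card, Fintype.card_fun, Fintype.card_coe,
    Fintype.card_fin]
  rfl

theorem sum_fixedSetCount_pow (hn : k * m ≤ n) :
    ∑ σ : Equiv.Perm (Fin n), fixedSetCount m σ ^ k = coverCount k m * n.factorial := by
  classical
  have : Fintype (MulAction.orbitRel.Quotient (Equiv.Perm (Fin n))
      (Fin k → Set.powersetCard (Fin n) m)) := Fintype.ofFinite _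
  have : ∀ σ : Equiv.Perm (Fin n),
      Fintype (MulAction.fixedBy (Fin k → Set.powersetCard (Fin n) m) σ) :=
    fun _ => Fintype.ofFinite _
  have h := MulAction.sum_card_fixedBy_eq_card_orbits_mul_card_group (Equiv.Perm (Fin n))
    (Fin k → Set.powersetCard (Fin n) m)
  simp only [← Nat.card_eq_fintype_card (α := MulAction.fixedBy _ _),
    card_fixedBy_eq_fixedSetCount_pow] at h
  rw [h, ← card_orbits_eq_coverCount hn, Nat.card_eq_fintype_card, Fintype.card_perm,
    Fintype.card_fin]

end Orbits

/-! ### Multiplicity vectors -/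

/-- The nonempty subsets of a `k`-element set. A collection of them is encoded by its function of
multiplicities `NonemptySubset k → ℕ`. -/
abbrev NonemptySubset (k : ℕ) : Type := {Γ : Finset (Fin k) // Γ.Nonempty}

/-- The number of members containing `i`, with multiplicity, in the collection of nonempty subsets
whose multiplicities are given by `c`. -/
def coverDegree {k : ℕ} (c : NonemptySubset k → ℕ) (i : Fin k) : ℕ :=
  ∑ Γ : NonemptySubset k, if i ∈ Γ.1 then c Γ else 0

/-- The functions with values at most `m`. All multiplicities that matter are bounded by `m`, and
sums over them are taken over this finite set. -/
def box (ι : Type*) [Fintype ι] [DecidableEq ι] (m : ℕ) : Finset (ι → ℕ) :=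
  Fintype.piFinset fun _ => Finset.range (m + 1)

theorem mem_box {ι : Type*} [Fintype ι] [DecidableEq ι] {m : ℕ} {f : ι → ℕ} :
    f ∈ box ι m ↔ ∀ a, f a ≤ m := by
  simp [box]

theorem le_coverDegree {k : ℕ} (c : NonemptySubset k → ℕ) {i : Fin k} {Γ : NonemptySubset k}
    (hi : i ∈ Γ.1) : c Γ ≤ coverDegree c i := by
  have := Finset.single_le_sum (f := fun Γ : NonemptySubset k => if i ∈ Γ.1 then c Γ else 0)
    (fun _ _ => Nat.zero_le _) (Finset.mem_univ Γ)
  simpa [hi, coverDegree] using this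

theorem mem_box_of_coverDegree_le {k m : ℕ} {c : NonemptySubset k → ℕ}
    (hc : ∀ i, coverDegree c i ≤ m) : c ∈ box (NonemptySubset k) m :=
  mem_box.2 fun Γ => (le_coverDegree c Γ.2.choose_spec).trans (hc _)

/-! ### Products of binomial coefficients -/

section Binomial

open MvPolynomial

theorem coeff_prod_X_pow_equivFunOnFinite {k : ℕ} (a l : Fin k → ℕ) :
    coeff (Finsupp.equivFunOnFinite.symm l) (∏ i, (X i : MvPolynomial (Fin k) ℕ) ^ a i) =
      if a = l then 1 else 0 := by
  have : ∏ i, (X i : MvPolynomial (Fin k) ℕ) ^ a i =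
      monomial (Finsupp.equivFunOnFinite.symm a) 1 := by
    rw [monomial_eq, Finsupp.prod_fintype _ _ (by simp)]
    simp
  rw [this, coeff_monomial]
  simp

theorem coeff_prod_one_add_X_pow {k : ℕ} (z : ℕ) (l : Fin k → ℕ) :
    coeff (Finsupp.equivFunOnFinite.symm l) (∏ i, (1 + X i : MvPolynomial (Fin k) ℕ) ^ z) =
      ∏ i, z.choose (l i) := by
  have h : ∀ a : Fin k → ℕ, ∏ i, (X i : MvPolynomial (Fin k) ℕ) ^ a i * (z.choose (a i) : ℕ) =
      C (∏ i, z.choose (a i)) * ∏ i, X i ^ a i := fun a => by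
    rw [Finset.prod_mul_distrib, mul_comm, map_prod]; simp
  simp_rw [add_comm (1 : MvPolynomial (Fin k) ℕ), add_pow, one_pow, mul_one]
  rw [Finset.prod_univ_sum, coeff_sum]
  simp_rw [h, coeff_C_mul, coeff_prod_X_pow_equivFunOnFinite, mul_ite, mul_one, mul_zero]
  rw [Finset.sum_ite_eq']
  split_ifs with hl
  · rfl
  · obtain ⟨i, hi⟩ : ∃ i, z < l i := by simpa [Fintype.mem_piFinset, Nat.lt_succ_iff] using hl
    exact (Finset.prod_eq_zero (Finset.mem_univ i) (Nat.choose_eq_zero_of_lt hi)).symm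

theorem prod_one_add_X_pow_eq {k : ℕ} (z : ℕ) :
    ∏ i, (1 + X i : MvPolynomial (Fin k) ℕ) ^ z =
      ∑ r ∈ Finset.range (z + 1), ∑ c ∈ Finset.piAntidiag Finset.univ r,
        C (z.choose r * Nat.multinomial Finset.univ c) * ∏ i, X i ^ coverDegree c i := by
  have h1 : ∏ i, (1 + X i : MvPolynomial (Fin k) ℕ) =
      (∑ Γ : NonemptySubset k, ∏ i ∈ Γ.1, X i) + 1 := by
    rw [Finset.prod_one_add, Finset.powerset_univ,
      ← Fintype.sum_subtype_add_sum_subtype (fun Γ : Finset (Fin k) => Γ.Nonempty)]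
    congr 1
    have : Unique {Γ : Finset (Fin k) // ¬ Γ.Nonempty} :=
      { default := ⟨∅, by simp⟩
        uniq := fun Γ => Subtype.ext (Finset.not_nonempty_iff_eq_empty.1 Γ.2) }
    rw [Fintype.sum_unique, Finset.not_nonempty_iff_eq_empty.1 this.default.2]
    simp
  have h2 : ∀ c : NonemptySubset k → ℕ, ∏ Γ, (∏ i ∈ Γ.1, (X i : MvPolynomial (Fin k) ℕ)) ^ c Γ =
      ∏ i, X i ^ coverDegree c i := fun c => by
    simp_rw [coverDegree, ← Finset.prod_pow_eq_pow_sum, ← Finset.prod_pow]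
    rw [Finset.prod_comm]
    refine Finset.prod_congr rfl fun Γ _ => ?_
    simp_rw [pow_ite, pow_zero]
    rw [Finset.prod_ite_mem, Finset.univ_inter]
  rw [Finset.prod_pow, h1, add_pow]
  refine Finset.sum_congr rfl fun r _ => ?_
  rw [Finset.sum_pow_eq_sum_piAntidiag, one_pow, mul_one, Finset.sum_mul]
  refine Finset.sum_congr rfl fun c _ => ?_
  rw [h2, map_mul]
  simp only [eq_natCast]
  ring

/-- Both sides count the `k`-tuples of subsets of a `z`-element set with cardinalities `l i`, on
the right according to the multiplicities of their nonempty atoms. -/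
theorem prod_choose_eq_sum {k m : ℕ} (z : ℕ) {l : Fin k → ℕ} (hl : ∀ i, l i ≤ m) :
    ∏ i, z.choose (l i) = ∑ c ∈ (box (NonemptySubset k) m).filter (fun c => coverDegree c = l),
      z.choose (∑ Γ, c Γ) * Nat.multinomial Finset.univ c := by
  rw [← coeff_prod_one_add_X_pow, prod_one_add_X_pow_eq, coeff_sum]
  simp_rw [coeff_sum, coeff_C_mul, coeff_prod_X_pow_equivFunOnFinite, mul_ite, mul_one, mul_zero,
    ← Finset.sum_filter]
  have h : ∀ r ∈ Finset.range (z + 1),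
      (∑ c ∈ (Finset.piAntidiag Finset.univ r).filter (fun c => coverDegree c = l),
        z.choose r * Nat.multinomial Finset.univ c) =
      ∑ c ∈ (box (NonemptySubset k) m).filter (fun c => coverDegree c = l),
        if ∑ Γ, c Γ = r then z.choose r * Nat.multinomial Finset.univ c else 0 := fun r _ => by
    rw [← Finset.sum_filter]
    refine Finset.sum_congr (Finset.ext fun c => ?_) fun _ _ => rfl
    simp only [Finset.mem_filter, Finset.mem_piAntidiag]
    constructor
    · rintro ⟨⟨h1, -⟩, h2⟩
      exact ⟨⟨mem_box_of_coverDegree_le fun i => h2 ▸ hl i, h2⟩, h1⟩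
    · rintro ⟨⟨-, h2⟩, h1⟩
      exact ⟨⟨h1, by simp⟩, h2⟩
  rw [Finset.sum_congr rfl h, Finset.sum_comm]
  refine Finset.sum_congr rfl fun c _ => ?_
  rw [Finset.sum_ite_eq]
  split_ifs with hz
  · rfl
  · rw [Nat.choose_eq_zero_of_lt (by simpa [Nat.lt_succ_iff] using hz), zero_mul]

end Binomial

/-! ### Binomial moments of Poisson variables -/

section Poisson

open NNReal

/-- The terms with `n < s` vanish, and the `s`-shifted series is a multiple of the Poisson
probabilities. -/
theorem hasSum_poisson_choose (r : ℝ≥0) (s : ℕ) :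
    HasSum (fun n : ℕ => Real.exp (-r) * r ^ n / n.factorial * (n.choose s : ℝ))
      ((r : ℝ) ^ s / s.factorial) := by
  rw [← hasSum_nat_add_iff' s, Finset.sum_eq_zero, sub_zero]
  · have h := (hasSum_one_poissonMeasure r).mul_right ((r : ℝ) ^ s / s.factorial)
    rw [one_mul] at h
    refine h.congr_fun fun n => ?_
    have hf : ((n + s).factorial : ℝ) = (n + s).choose s * n.factorial * s.factorial := by
      exact_mod_cast (Nat.add_choose_mul_factorial_mul_factorial n s).symm
    have hc : ((n + s).choose s : ℝ) ≠ 0 := by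
      exact_mod_cast (Nat.choose_pos (Nat.le_add_left s n)).ne'
    rw [hf, pow_add]
    field_simp
  · intro i hi
    rw [Nat.choose_eq_zero_of_lt (Finset.mem_range.1 hi)]; simp

theorem integrable_poisson_choose (r : ℝ≥0) (s : ℕ) :
    Integrable (fun n : ℕ => (n.choose s : ℝ)) (poissonMeasure r) := by
  rw [integrable_poissonMeasure_iff]
  simpa using (hasSum_poisson_choose r s).summable

theorem integral_poisson_choose (r : ℝ≥0) (s : ℕ) :
    ∫ n : ℕ, (n.choose s : ℝ) ∂poissonMeasure r = (r : ℝ) ^ s / s.factorial := by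
  rw [integral_poissonMeasure]
  simpa using (hasSum_poisson_choose r s).tsum_eq

theorem integrable_poisson_prod_choose {k : ℕ} (r : ℝ≥0) (l : Fin k → ℕ) :
    Integrable (fun n : ℕ => ∏ i, (n.choose (l i) : ℝ)) (poissonMeasure r) := by
  have h : ∀ n : ℕ, ∏ i, (n.choose (l i) : ℝ) = _ := fun n => by
    rw [← Nat.cast_prod, prod_choose_eq_sum n
      (fun i => Finset.single_le_sum (f := l) (fun _ _ => Nat.zero_le _) (Finset.mem_univ i)),
      Nat.cast_sum]
  simp_rw [h, Nat.cast_mul]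
  exact integrable_finsetSum _ fun c _ => (integrable_poisson_choose r _).mul_const _

theorem integral_poisson_prod_choose {k m : ℕ} (r : ℝ≥0) {l : Fin k → ℕ} (hl : ∀ i, l i ≤ m) :
    ∫ n : ℕ, ∏ i, (n.choose (l i) : ℝ) ∂poissonMeasure r =
      ∑ c ∈ (box (NonemptySubset k) m).filter (fun c => coverDegree c = l),
        ∏ Γ, (r : ℝ) ^ c Γ / (c Γ).factorial := by
  have h : ∀ n : ℕ, ∏ i, (n.choose (l i) : ℝ) = _ := fun n => by
    rw [← Nat.cast_prod, prod_choose_eq_sum n hl, Nat.cast_sum]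
  simp_rw [h, Nat.cast_mul]
  rw [integral_finsetSum _ fun c _ => (integrable_poisson_choose r _).mul_const _]
  refine Finset.sum_congr rfl fun c _ => ?_
  rw [integral_mul_const, integral_poisson_choose, Finset.prod_div_distrib,
    Finset.prod_pow_eq_pow_sum, div_mul_eq_mul_div, div_eq_div_iff (by positivity) (by positivity),
    mul_assoc]
  congr 1
  rw [mul_comm]
  exact_mod_cast Nat.multinomial_spec Finset.univ c

end Poisson

/-! ### The total weight of the cycle types of a given size -/

section CycleType

/-- The number of points of a permutation with `c j` cycles of length `j + 1` for each `j`. -/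
def cycleSize {m : ℕ} (c : Fin m → ℕ) : ℕ := ∑ j : Fin m, ((j : ℕ) + 1) * c j

/-- The factor `1 / (ℓ ^ c * c!)`, `ℓ = j + 1`, which `c` cycles of length `ℓ` contribute to the
probability of a cycle type. -/
noncomputable def cycleWeight {m : ℕ} (j : Fin m) (c : ℕ) : ℝ :=
  (1 / ((j : ℝ) + 1)) ^ c / c.factorial

theorem le_cycleSize {m : ℕ} (c : Fin m → ℕ) (j : Fin m) : c j ≤ cycleSize c :=
  (Nat.le_mul_of_pos_left _ (Nat.succ_pos _)).trans
    (Finset.single_le_sum (f := fun j : Fin m => ((j : ℕ) + 1) * c j)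
      (fun _ _ => Nat.zero_le _) (Finset.mem_univ j))

theorem mem_box_of_cycleSize_le {m : ℕ} {c : Fin m → ℕ} (hc : cycleSize c ≤ m) :
    c ∈ box (Fin m) m :=
  mem_box.2 fun j => (le_cycleSize c j).trans hc

theorem cycleSize_add_single {m : ℕ} (c : Fin m → ℕ) (j : Fin m) :
    cycleSize (c + Pi.single j 1) = cycleSize c + (j + 1) := by
  simp [cycleSize, mul_add, Finset.sum_add_distrib, Pi.single_apply]

theorem cycleWeight_succ {m : ℕ} (j : Fin m) (c : ℕ) :
    (((j : ℕ) + 1) * (c + 1 : ℕ) : ℝ) * cycleWeight j (c + 1) = cycleWeight j c := by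
  unfold cycleWeight
  rw [Nat.factorial_succ, pow_succ]
  have : ((c : ℝ) + 1) ≠ 0 := by positivity
  push_cast
  field_simp

theorem prod_cycleWeight_add_single {m : ℕ} (c : Fin m → ℕ) (j : Fin m) :
    (((j : ℕ) + 1) * (c j + 1 : ℕ) : ℝ) * ∏ i, cycleWeight i ((c + Pi.single j 1 : Fin m → ℕ) i) =
      ∏ i, cycleWeight i (c i) := by
  rw [← Finset.mul_prod_erase _ _ (Finset.mem_univ j), ← Finset.mul_prod_erase _
    (fun i => cycleWeight i (c i)) (Finset.mem_univ j), ← mul_assoc]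
  simp only [Pi.add_apply, Pi.single_eq_same]
  rw [cycleWeight_succ]
  congr 1
  refine Finset.prod_congr rfl fun i hi => ?_
  rw [Pi.single_eq_of_ne (Finset.ne_of_mem_erase hi), add_zero]

/-- Removing one cycle of length `j + 1`. -/
theorem sum_cycleWeight_mul_part {m d : ℕ} (hd : d ≤ m) (j : Fin m) :
    ∑ c ∈ (box (Fin m) m).filter (fun c => cycleSize c = d),
      (((j : ℕ) + 1) * c j : ℝ) * ∏ i, cycleWeight i (c i) =
    if (j : ℕ) < d then ∑ c ∈ (box (Fin m) m).filter (fun c => cycleSize c = d - (j + 1)),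
      ∏ i, cycleWeight i (c i) else 0 := by
  split_ifs with hj
  · symm
    refine Finset.sum_bij_ne_zero (fun c _ _ => c + Pi.single j 1) ?_ ?_ ?_ ?_
    · intro c hc _
      have h := (Finset.mem_filter.1 hc).2
      have h2 : cycleSize (c + Pi.single j 1) = d := by rw [cycleSize_add_single]; omega
      exact Finset.mem_filter.2 ⟨mem_box_of_cycleSize_le (h2 ▸ hd), h2⟩
    · intro c _ _ c' _ _ h
      exact add_right_cancel h
    · intro c hc h0
      have hcj : c j ≠ 0 := fun h => h0 (by simp [h])
      have hle : Pi.single j 1 ≤ c := by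
        intro i
        by_cases hi : i = j
        · subst hi; simpa using Nat.one_le_iff_ne_zero.2 hcj
        · simp [Pi.single_eq_of_ne hi]
      have hsub : c - Pi.single j 1 + Pi.single j 1 = c := tsub_add_cancel_of_le hle
      have h2 : cycleSize (c - Pi.single j 1) = d - (j + 1) := by
        have := cycleSize_add_single (c - Pi.single j 1) j
        rw [hsub, (Finset.mem_filter.1 hc).2] at this
        omega
      refine ⟨_, Finset.mem_filter.2 ⟨mem_box_of_cycleSize_le (by omega), h2⟩, ?_, hsub⟩
      refine (Finset.prod_pos fun i _ => ?_).ne'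
      unfold cycleWeight
      positivity
    · intro c _ _
      rw [← prod_cycleWeight_add_single c j]
      simp
  -- There is no room for a cycle of length `j + 1 > d`, so `c j = 0`.
  · refine Finset.sum_eq_zero fun c hc => ?_
    have h1 : ((j : ℕ) + 1) * c j ≤ d := by
      rw [← (Finset.mem_filter.1 hc).2]
      exact Finset.single_le_sum (f := fun j : Fin m => ((j : ℕ) + 1) * c j)
        (fun _ _ => Nat.zero_le _) (Finset.mem_univ j)
    have h2 : c j = 0 := by
      by_contra h
      have := Nat.le_mul_of_pos_right ((j : ℕ) + 1) (Nat.pos_of_ne_zero h)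
      omega
    simp [h2]

/-- The cycle types of permutations of `d` points have total probability one. If `a d` is the left
hand side, weighting each cycle type by its size `d = ∑ j, (j + 1) * c j` and removing a cycle gives
the recursion `d * a d = ∑ j < d, a (d - (j + 1))`. -/
theorem sum_prod_cycleWeight_eq_one {m d : ℕ} (hd : d ≤ m) :
    ∑ c ∈ (box (Fin m) m).filter (fun c => cycleSize c = d), ∏ j, cycleWeight j (c j) = 1 := by
  induction d using Nat.strong_induction_on with
  | _ d ih =>
    rcases Nat.eq_zero_or_pos d with rfl | hpos
    · have : (box (Fin m) m).filter (fun c => cycleSize c = 0) = {0} := by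
        refine Finset.ext fun c => ?_
        rw [Finset.mem_filter, Finset.mem_singleton]
        refine ⟨fun h => funext fun j => ?_, fun h => ?_⟩
        · have := le_cycleSize c j
          rw [h.2] at this
          simpa using this
        · subst h
          exact ⟨mem_box.2 fun _ => Nat.zero_le _, by simp [cycleSize]⟩
      rw [this]
      simp [cycleWeight]
    · have hd0 : (d : ℝ) ≠ 0 := by positivity
      refine mul_left_cancel₀ hd0 ?_
      rw [mul_one, Finset.mul_sum]
      have h1 : ∀ c ∈ (box (Fin m) m).filter (fun c => cycleSize c = d),
          (d : ℝ) * ∏ j, cycleWeight j (c j) =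
            ∑ j : Fin m, (((j : ℕ) + 1) * c j : ℝ) * ∏ i, cycleWeight i (c i) := fun c hc => by
        rw [← Finset.sum_mul, ← (Finset.mem_filter.1 hc).2, cycleSize]
        push_cast
        rfl
      rw [Finset.sum_congr rfl h1, Finset.sum_comm]
      have h2 : ∀ j : Fin m, ∑ c ∈ (box (Fin m) m).filter (fun c => cycleSize c = d),
          (((j : ℕ) + 1) * c j : ℝ) * ∏ i, cycleWeight i (c i) =
            if (j : ℕ) < d then 1 else 0 := fun j => by
        rw [sum_cycleWeight_mul_part hd j]
        split_ifs with hj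
        · exact ih _ (by omega) (by omega)
        · rfl
      rw [Finset.sum_congr rfl fun j _ => h2 j, Fin.sum_univ_eq_sum_range
        (fun j => if j < d then (1 : ℝ) else 0), ← Finset.sum_filter]
      have : (Finset.range m).filter (· < d) = Finset.range d := by
        ext x; simp; omega
      rw [this]; simp

end CycleType

/-! ### Covers as vectors of multiplicities -/

section Counting

/-- The multiplicity vectors of the `m`-covers of a `k`-element set. -/
def coverVectors (k m : ℕ) : Finset (NonemptySubset k → ℕ) :=
  (box (NonemptySubset k) m).filter fun d => ∀ i, coverDegree d i = m

theorem mem_coverVectors {k m : ℕ} {d : NonemptySubset k → ℕ} :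
    d ∈ coverVectors k m ↔ ∀ i, coverDegree d i = m := by
  rw [coverVectors, Finset.mem_filter]
  exact ⟨fun h => h.2, fun h => ⟨mem_box_of_coverDegree_le fun i => (h i).le, h⟩⟩

theorem countP_mem_eq_coverDegree {k : ℕ} {S : Multiset (Finset (Fin k))}
    (hS : ∀ Γ ∈ S, Γ.Nonempty) (i : Fin k) :
    S.countP (fun Γ => i ∈ Γ) = coverDegree (fun Γ => S.count Γ.1) i := by
  induction S using Multiset.induction_on with
  | empty => simp [coverDegree]
  | cons Γ S ih =>
    have hΓ := hS Γ (Multiset.mem_cons_self _ _)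
    rw [Multiset.countP_cons, ih fun Δ hΔ => hS Δ (Multiset.mem_cons_of_mem hΔ)]
    have h : ∀ Δ : NonemptySubset k, (if i ∈ Δ.1 then (Γ ::ₘ S).count Δ.1 else 0) =
        (if i ∈ Δ.1 then S.count Δ.1 else 0) +
          if Δ = ⟨Γ, hΓ⟩ then (if i ∈ Γ then 1 else 0) else 0 := fun Δ => by
      rw [Multiset.count_cons]
      by_cases hΔ : Δ = ⟨Γ, hΓ⟩
      · subst hΔ; by_cases hi : i ∈ Γ <;> simp [hi]
      · have : Δ.1 ≠ Γ := fun h => hΔ (Subtype.ext h)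
        simp [hΔ, this]
    unfold coverDegree
    simp_rw [h, Finset.sum_add_distrib]
    simp

theorem coverCount_eq_card_coverVectors (k m : ℕ) : coverCount k m = (coverVectors k m).card := by
  rw [coverCount, ← Set.ncard_coe_finset]
  refine Set.ncard_congr (fun S _ Γ => S.count Γ.1) ?_ ?_ ?_
  · intro S hS
    refine Finset.mem_coe.2 (mem_coverVectors.2 fun i => ?_)
    rw [← countP_mem_eq_coverDegree hS.1, hS.2]
  · intro S T hS hT h
    refine Multiset.ext.2 fun Γ => ?_
    by_cases hΓ : Γ.Nonempty
    · exact congrFun h ⟨Γ, hΓ⟩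
    · rw [Multiset.count_eq_zero_of_notMem fun h => hΓ (hS.1 Γ h),
        Multiset.count_eq_zero_of_notMem fun h => hΓ (hT.1 Γ h)]
  · intro d hd
    let S : Multiset (Finset (Fin k)) := ∑ Γ : NonemptySubset k, Multiset.replicate (d Γ) Γ.1
    have hS : ∀ Γ ∈ S, Γ.Nonempty := fun Γ hΓ => by
      obtain ⟨Δ, -, hΔ⟩ := Multiset.mem_sum.1 hΓ
      rw [Multiset.eq_of_mem_replicate hΔ]
      exact Δ.2
    have hcount : (fun Γ : NonemptySubset k => S.count Γ.1) = d := funext fun Γ => by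
      simp [S, Multiset.count_sum', Multiset.count_replicate, Subtype.val_inj]
    refine ⟨S, ⟨hS, fun j => ?_⟩, hcount⟩
    rw [countP_mem_eq_coverDegree hS, hcount]
    exact mem_coverVectors.1 (Finset.mem_coe.1 hd) j

theorem coverCount_one (m : ℕ) : coverCount 1 m = 1 := by
  have hmem : ∀ Γ : NonemptySubset 1, ∀ i, i ∈ Γ.1 := by decide
  have : Unique (NonemptySubset 1) :=
    { default := ⟨Finset.univ, by simp⟩
      uniq := by decide }
  rw [coverCount_eq_card_coverVectors, Finset.card_eq_one]
  refine ⟨fun _ => m, Finset.ext fun d => ?_⟩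
  rw [mem_coverVectors, Finset.mem_singleton]
  have h : ∀ i, coverDegree d i = d default := fun i => by
    rw [coverDegree, Fintype.sum_unique, if_pos (hmem _ i)]
  simp_rw [h]
  refine ⟨fun h => funext fun Γ => ?_, fun h i => by rw [h]⟩
  rw [Unique.eq_default Γ, h 0]

theorem coverCount_two (m : ℕ) : coverCount 2 m = m + 1 := by
  let a : NonemptySubset 2 := ⟨{0}, by simp⟩
  let b : NonemptySubset 2 := ⟨{1}, by simp⟩
  let u : NonemptySubset 2 := ⟨Finset.univ, by simp⟩
  have huniv : (Finset.univ : Finset (NonemptySubset 2)) = {a, b, u} := by decide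
  have hmem : ∀ Γ : NonemptySubset 2, Γ = a ∨ Γ = b ∨ Γ = u := by decide
  have h0 : ∀ d, coverDegree d 0 = d a + d u := fun d => by
    rw [coverDegree, huniv, Finset.sum_insert (by decide), Finset.sum_insert (by decide)]
    simp [a, b, u]
  have h1 : ∀ d, coverDegree d 1 = d b + d u := fun d => by
    rw [coverDegree, huniv, Finset.sum_insert (by decide), Finset.sum_insert (by decide)]
    simp [a, b, u]
  have hmemc : ∀ d, d ∈ coverVectors 2 m ↔ d a + d u = m ∧ d b + d u = m := fun d => by
    rw [mem_coverVectors, Fin.forall_fin_two, h0, h1]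
  rw [coverCount_eq_card_coverVectors, ← Finset.card_range (m + 1)]
  refine Finset.card_bij (fun d _ => d u) ?_ ?_ ?_
  · intro d hd
    have := (hmemc d).1 hd
    rw [Finset.mem_range]; omega
  · intro d hd d' hd' h
    have h2 := (hmemc d).1 hd
    have h3 := (hmemc d').1 hd'
    funext Γ
    rcases hmem Γ with rfl | rfl | rfl <;> omega
  · intro t ht
    rw [Finset.mem_range] at ht
    have hau : a ≠ u := by decide
    have hbu : b ≠ u := by decide
    refine ⟨fun Γ => if Γ = u then t else m - t, (hmemc _).2 ?_, if_pos rfl⟩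
    simp only [if_neg hau, if_neg hbu, if_true]
    omega

end Counting

/-! ### Regrouping the expanded moments -/

/-- The constraints `l j ≤ z j` may be dropped, since the binomial coefficients vanish when they
fail. -/
theorem fixedSetSum_eq_sum_box (m : ℕ) (z : Fin m → ℕ) :
    fixedSetSum m z = ∑ l ∈ (box (Fin m) m).filter (fun l => cycleSize l = m),
      ∏ j, (z j).choose (l j) := by
  refine Finset.sum_subset ?_ ?_
  · intro l hl
    have h : cycleSize l = m := (Finset.mem_filter.1 hl).2
    exact Finset.mem_filter.2 ⟨mem_box_of_cycleSize_le h.le, h⟩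
  · intro l hl hl'
    have h : cycleSize l = m := (Finset.mem_filter.1 hl).2
    obtain ⟨j, hj⟩ : ∃ j, z j < l j := by
      by_contra! hle
      refine hl' (Finset.mem_filter.2 ⟨Fintype.mem_piFinset.2 fun j => ?_, h⟩)
      exact Finset.mem_range.2 (Nat.lt_succ_of_le (hle j))
    exact Finset.prod_eq_zero (Finset.mem_univ j) (Nat.choose_eq_zero_of_lt hj)

theorem fixedSetSum_pow_eq_sum (m k : ℕ) (z : Fin m → ℕ) :
    (fixedSetSum m z : ℝ) ^ k = ∑ L ∈ Fintype.piFinset fun _ : Fin k =>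
      (box (Fin m) m).filter (fun l => cycleSize l = m),
        ∏ j, ∏ i, ((z j).choose (L i j) : ℝ) := by
  rw [fixedSetSum_eq_sum_box, Nat.cast_sum, Finset.sum_pow']
  refine Finset.sum_congr rfl fun L _ => ?_
  simp_rw [Nat.cast_prod]
  exact Finset.prod_comm

theorem coverDegree_cycleSize {m k : ℕ} (C : Fin m → NonemptySubset k → ℕ) (i : Fin k) :
    coverDegree (fun Γ => cycleSize fun j => C j Γ) i = cycleSize fun j => coverDegree (C j) i := by
  simp only [coverDegree, cycleSize, Finset.mul_sum]
  rw [Finset.sum_comm]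
  refine Finset.sum_congr rfl fun Γ _ => ?_
  split_ifs <;> simp

/-- Both sides are sums of `∏ j, ∏ Γ, w j (c j Γ)` over the same arrays `c`. On the left the arrays
are grouped by the degrees `coverDegree (c j) i`, on the right by `cycleSize fun j => c j Γ`, and
the two forms of the constraint agree by `coverDegree_cycleSize`. -/
theorem sum_prod_sum_coverDegree_eq {m k : ℕ} (w : Fin m → ℕ → ℝ) :
    ∑ L ∈ Fintype.piFinset fun _ : Fin k => (box (Fin m) m).filter (fun l => cycleSize l = m),
      ∏ j, ∑ c ∈ (box (NonemptySubset k) m).filter (fun c => coverDegree c = fun i => L i j),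
        ∏ Γ, w j (c Γ) =
    ∑ d ∈ coverVectors k m, ∏ Γ,
      ∑ c ∈ (box (Fin m) m).filter (fun c => cycleSize c = d Γ), ∏ j, w j (c j) := by
  simp_rw [Finset.prod_univ_sum]
  have hmem : ∀ C : Fin m → NonemptySubset k → ℕ,
      (∀ i, (cycleSize fun j => coverDegree (C j) i) = m) →
        ∀ j, C j ∈ box (NonemptySubset k) m := fun C hC j =>
    mem_box_of_coverDegree_le fun i =>
      (le_cycleSize (fun j => coverDegree (C j) i) j).trans (hC i).le
  have hmem' : ∀ D : NonemptySubset k → Fin m → ℕ,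
      (∀ i, coverDegree (fun Γ => cycleSize (D Γ)) i = m) →
        ∀ Γ, D Γ ∈ box (Fin m) m := fun D hD Γ =>
    mem_box_of_cycleSize_le ((le_coverDegree (fun Γ => cycleSize (D Γ)) Γ.2.choose_spec).trans
      (hD _).le)
  -- On either side the array determines the grouping index, so after exchanging the sums the
  -- inner one has a single term.
  rw [Finset.sum_comm' (t' := (Fintype.piFinset fun _ : Fin m => box (NonemptySubset k) m).filter
      fun C => ∀ i, (cycleSize fun j => coverDegree (C j) i) = m)
    (s' := fun C => {fun i j => coverDegree (C j) i}),
    Finset.sum_comm' (s := coverVectors k m)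
      (t' := (Fintype.piFinset fun _ : NonemptySubset k => box (Fin m) m).filter
      fun D => ∀ i, coverDegree (fun Γ => cycleSize (D Γ)) i = m)
    (s' := fun D => {fun Γ => cycleSize (D Γ)})]
  · simp_rw [Finset.sum_singleton]
    refine Finset.sum_nbij' (fun C Γ j => C j Γ) (fun D j Γ => D Γ j) ?_ ?_ (fun _ _ => rfl)
      (fun _ _ => rfl) (fun _ _ => Finset.prod_comm)
    · intro C hC
      have h : ∀ i, coverDegree (fun Γ => cycleSize fun j => C j Γ) i = m := fun i => by
        rw [coverDegree_cycleSize]; exact (Finset.mem_filter.1 hC).2 i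
      exact Finset.mem_filter.2 ⟨Fintype.mem_piFinset.2 (hmem' _ h), h⟩
    · intro D hD
      have h : ∀ i, (cycleSize fun j => coverDegree (fun Γ => D Γ j) i) = m := fun i => by
        rw [← coverDegree_cycleSize fun j Γ => D Γ j]; exact (Finset.mem_filter.1 hD).2 i
      exact Finset.mem_filter.2 ⟨Fintype.mem_piFinset.2 (hmem _ h), h⟩
  · intro d D
    simp only [Fintype.mem_piFinset, Finset.mem_filter, Finset.mem_singleton, mem_coverVectors]
    constructor
    · rintro ⟨hd, hD⟩
      have : d = fun Γ => cycleSize (D Γ) := funext fun Γ => (hD Γ).2.symm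
      subst this
      exact ⟨rfl, fun Γ => (hD Γ).1, hd⟩
    · rintro ⟨rfl, hD, hd⟩
      exact ⟨hd, fun Γ => ⟨hD Γ, rfl⟩⟩
  · intro L C
    simp only [Fintype.mem_piFinset, Finset.mem_filter, Finset.mem_singleton]
    constructor
    · rintro ⟨hL, hC⟩
      have : L = fun i j => coverDegree (C j) i :=
        funext fun i => funext fun j => (congrFun (hC j).2 i).symm
      subst this
      exact ⟨rfl, fun j => (hC j).1, fun i => (hL i).2⟩
    · rintro ⟨rfl, hC, hL⟩
      exact ⟨fun i => ⟨mem_box_of_cycleSize_le (hL i).le, hL i⟩, fun j => ⟨hC j, rfl⟩⟩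

/-! ### Moments -/

section Moments

open NNReal

theorem integrable_prod_prod_choose {m k : ℕ} (r : Fin m → ℝ≥0) (L : Fin k → Fin m → ℕ) :
    Integrable (fun z : Fin m → ℕ => ∏ j, ∏ i, ((z j).choose (L i j) : ℝ))
      (Measure.pi fun j => poissonMeasure (r j)) := by
  have h : ∀ j, Integrable ((fun (j : Fin m) (n : ℕ) => ∏ i, (n.choose (L i j) : ℝ)) j)
      (poissonMeasure (r j)) := fun j => integrable_poisson_prod_choose (r j) fun i => L i j
  exact Integrable.fintype_prod h

theorem integrable_fixedSetSum_pow (m k : ℕ) (r : Fin m → ℝ≥0) :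
    Integrable (fun z => (fixedSetSum m z : ℝ) ^ k)
      (Measure.pi fun j => poissonMeasure (r j)) := by
  simp_rw [fixedSetSum_pow_eq_sum]
  exact integrable_finsetSum _ fun L _ => integrable_prod_prod_choose _ L

theorem integral_fixedSetSum_pow (m k : ℕ) :
    ∫ z, (fixedSetSum m z : ℝ) ^ k
      ∂(Measure.pi fun j : Fin m => poissonMeasure (1 / ((j : ℝ≥0) + 1))) = coverCount k m := by
  simp_rw [fixedSetSum_pow_eq_sum]
  rw [integral_finsetSum _ fun L _ => integrable_prod_prod_choose _ L]
  have h : ∀ L ∈ Fintype.piFinset fun _ : Fin k =>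
      (box (Fin m) m).filter (fun l => cycleSize l = m),
      ∫ z : Fin m → ℕ, ∏ j, ∏ i, ((z j).choose (L i j) : ℝ)
        ∂(Measure.pi fun j : Fin m => poissonMeasure (1 / ((j : ℝ≥0) + 1))) =
      ∏ j, ∑ c ∈ (box (NonemptySubset k) m).filter (fun c => coverDegree c = fun i => L i j),
        ∏ Γ, cycleWeight j (c Γ) := fun L hL => by
    refine (integral_fintype_prod_eq_prod
      (fun (j : Fin m) (n : ℕ) => ∏ i, (n.choose (L i j) : ℝ))).trans ?_
    refine Finset.prod_congr rfl fun j _ => ?_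
    rw [integral_poisson_prod_choose (m := m) _ fun i =>
      mem_box.1 (Finset.mem_filter.1 (Fintype.mem_piFinset.1 hL i)).1 j]
    simp [cycleWeight]
  rw [Finset.sum_congr rfl h, sum_prod_sum_coverDegree_eq, coverCount_eq_card_coverVectors,
    Finset.card_eq_sum_ones, Nat.cast_sum]
  refine Finset.sum_congr rfl fun d hd => ?_
  rw [Nat.cast_one]
  refine Finset.prod_eq_one fun Γ _ => sum_prod_cycleWeight_eq_one ?_
  exact mem_box.1 (Finset.mem_filter.1 hd).1 Γ

end Moments

theorem theorem1 {Ω : Type*} [MeasurableSpace Ω] (P : MeasureTheory.Measure Ω)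
    [MeasureTheory.IsProbabilityMeasure P] (m : ℕ) (Z : Fin m → Ω → ℕ)
    (hZ : ∀ j : Fin m, ProbabilityTheory.HasLaw (Z j)
      (ProbabilityTheory.poissonMeasure (1 / ((j : NNReal) + 1))) P)
    (hindep : ProbabilityTheory.iIndepFun Z P)
    (E : Ω → ℝ) (hE : ∀ ω, E ω = (fixedSetSum m (fun j => Z j ω) : ℝ)) :
    (∀ k : ℕ, MeasureTheory.Integrable (fun ω => E ω ^ k) P ∧
      ∫ ω, E ω ^ k ∂P = (coverCount k m : ℝ)) ∧
    ∫ ω, E ω ∂P = 1 ∧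
    ∫ ω, E ω ^ 2 ∂P = (m : ℝ) + 1 ∧
    ProbabilityTheory.variance E P = (m : ℝ) ∧
    (∀ k n : ℕ, k * m ≤ n →
      (∑ σ : Equiv.Perm (Fin n), (fixedSetCount m σ : ℝ) ^ k) / (n.factorial : ℝ)
        = (coverCount k m : ℝ)) := by
  have hlaw := hindep.hasLaw_pi hZ
  obtain rfl : E = fun ω => (fixedSetSum m (fun j => Z j ω) : ℝ) := funext hE
  have hmoment : ∀ k : ℕ, Integrable (fun ω => (fixedSetSum m (fun j => Z j ω) : ℝ) ^ k) P ∧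
      ∫ ω, (fixedSetSum m (fun j => Z j ω) : ℝ) ^ k ∂P = (coverCount k m : ℝ) := fun k => by
    have hint := integrable_fixedSetSum_pow m k fun j => 1 / ((j : NNReal) + 1)
    refine ⟨?_, ?_⟩
    · rw [← hlaw.map_eq] at hint
      exact hint.comp_aemeasurable hlaw.aemeasurable
    · rw [← integral_fixedSetSum_pow m k]
      exact hlaw.integral_comp hint.aestronglyMeasurable
  have h1 := (hmoment 1).2
  have h2 := (hmoment 2).2
  simp only [pow_one, coverCount_one, Nat.cast_one] at h1
  rw [coverCount_two] at h2
  push_cast at h2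
  refine ⟨hmoment, h1, h2, ?_, fun k n hn => ?_⟩
  · have hmeas : AEStronglyMeasurable (fun ω => (fixedSetSum m (fun j => Z j ω) : ℝ)) P := by
      simpa using (hmoment 1).1.aestronglyMeasurable
    rw [variance_eq_sub ((memLp_two_iff_integrable_sq hmeas).2 (hmoment 2).1)]
    simp only [Pi.pow_apply]
    rw [h1, h2]
    ring
  · rw [div_eq_iff (by positivity)]
    exact_mod_cast sum_fixedSetCount_pow hn
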